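/- Let $\Omega$ be a bounded pseudoconvex domain in $\mathbb C^n$. Suppose there exist $t_0>0$, a family $\{\Omega^t\}_{0<t\le t_0}$ of pseudoconvex domains in $\mathbb C^n$ with $\overline{\Omega}\subset\Omega^t$ for all $t\in(0,t_0]$, and a continuous increasing (i.e. nondecreasing) function $\eta:(0,t_0]\to(0,\infty)$ such that $$\eta(t)\le \delta_{\Omega^t}(z):=d(z,\partial\Omega^t)\le t\qquad\text{for all } z\in\partial\Omega,\ 0<t\le t_0,$$ and $$\int_0^{r_0}\frac{dt}{t\,\log[t/\eta(t)]}=\infty\qquad\text{for all sufficiently small } r_0>0,$$ where the integrand is $+\infty$ at points where $\eta(t)=t$. (If $\eta(t)<t$ for all $t\in(0,t_0]$, it is enough that the integral diverges for one $r_0\in(0,t_0]$.) Then $\Omega$ is hyperconvex: there is a negative continuous plurisubharmonic function $\rho$ on $\Omega$ such that $\{z\in\Omega:\rho(z)<-c\}$ is relatively compact in $\Omega$ for every $c>0$. Here a domain is a nonempty connected open set, $d$ is the Euclidean distance, and a domain $D$ is pseudoconvex if $-\log\delta_D$ is plurisubharmonic on $D$ (with $D=\mathbb C^n$ counted as pseudoconvex).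 -/

import Mathlib

open Set MeasureTheory

/-- The boundary distance `δ_Ω(z) = d(z, ∂Ω)` in `ℂⁿ` with the Euclidean norm.
When `∂Ω` is empty (for example `Ω = ℂⁿ`), where the true distance is `∞`, the value is `0`;
a lower bound `0 < η ≤ δ_Ω(z)` thus forces `∂Ω` to be nonempty. -/
noncomputable def boundaryDist {n : ℕ} (Ω : Set (EuclideanSpace ℂ (Fin n)))
    (z : EuclideanSpace ℂ (Fin n)) : ℝ :=
  Metric.infDist z (frontier Ω)

/-- A (finite-valued) function `u` is plurisubharmonic on the open set `Ω ⊆ ℂⁿ`: it is upper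
semicontinuous and, for every closed complex disc `{z + ζ w : |ζ| ≤ 1}` contained in `Ω`, the
value `u z` is at most the mean of `u` over the boundary circle of the disc.  (Since `u z > -∞`,
the mean inequality includes that `u` is integrable on the circle; this is stated explicitly.) -/
def IsPSHOn {n : ℕ} (u : EuclideanSpace ℂ (Fin n) → ℝ)
    (Ω : Set (EuclideanSpace ℂ (Fin n))) : Prop :=
  UpperSemicontinuousOn u Ω ∧
    ∀ z w : EuclideanSpace ℂ (Fin n),
      (∀ ζ : ℂ, ‖ζ‖ ≤ 1 → z + ζ • w ∈ Ω) →
        CircleIntegrable (fun ζ : ℂ => u (z + ζ • w)) 0 1 ∧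
          u z ≤ Real.circleAverage (fun ζ : ℂ => u (z + ζ • w)) 0 1

/-- A pseudoconvex domain in `ℂⁿ`: a nonempty connected open set `Ω` for which `-log δ_Ω` is
plurisubharmonic on `Ω`.  (For `Ω = ℂⁿ` the function below is constant, so `ℂⁿ` is
pseudoconvex, as it should be.) -/
def IsPseudoconvexDomain {n : ℕ} (Ω : Set (EuclideanSpace ℂ (Fin n))) : Prop :=
  IsOpen Ω ∧ IsConnected Ω ∧ IsPSHOn (fun z => -Real.log (boundaryDist Ω z)) Ω

/-- A hyperconvex domain in `ℂⁿ`: a bounded domain `Ω` carrying a negative continuous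
plurisubharmonic function `ρ` with `{ρ < -c}` relatively compact in `Ω` for all `c > 0`. -/
def IsHyperconvexDomain {n : ℕ} (Ω : Set (EuclideanSpace ℂ (Fin n))) : Prop :=
  IsOpen Ω ∧ IsConnected Ω ∧ Bornology.IsBounded Ω ∧
    ∃ ρ : EuclideanSpace ℂ (Fin n) → ℝ,
      (∀ z ∈ Ω, ρ z < 0) ∧ ContinuousOn ρ Ω ∧ IsPSHOn ρ Ω ∧
        ∀ c : ℝ, 0 < c →
          IsCompact (closure {z | z ∈ Ω ∧ ρ z < -c}) ∧ closure {z | z ∈ Ω ∧ ρ z < -c} ⊆ Ω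

/-! Fix a scale `t` and put `e = η t`. On `Ω` one has `δ_Ω + e ≤ δ_{Ω^t} ≤ δ_Ω + t`
(`boundaryDist_add_le`, `boundaryDist_le_add`), so `φ = log e - log δ_{Ω^t}` is negative and
plurisubharmonic there. It is at most `-A = -log ((4t + e) / e)` where `δ_Ω ≥ 4t` and at least `-B =
-log (2t / e)` where `δ_Ω ≤ t`. Thus a multiple of `φ` lying below `-M` away from the boundary lies
above `-M * B / A` close to it.

With `r k = t₀ / 4 ^ k` and `t = r (k + 1)`, these multiples are glued successively by maxima,
starting from `-1`. Near the boundary the lower bounds improve by the factors `B / A ≤ 1 - log 2 /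
A`, and their product tends to `0` because `∑ 1 / A` diverges, which is the integral hypothesis read
at the scales `r k` (`not_summable_of_lintegral_eq_top`, `tendsto_prod_zero_of_not_summable`). The
glued functions are locally eventually constant in `k`, and their limit is the exhaustion
(`isHyperconvexDomain_of_barriers`). Plurisubharmonicity of the maxima is checked locally through
`IsPSHOn.of_local_touch`. -/

/-! ### Sub-mean value inequalities: from local to global. -/

/-- On the unit circle, continuous real functions are uniform limits of real parts of polynomials. -/
theorem exists_polynomial_re_approx {f : ℂ → ℝ} (hf : ContinuousOn f (Metric.sphere 0 1))
    {ε : ℝ} (hε : 0 < ε) :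
    ∃ P : Polynomial ℂ, ∀ ζ : ℂ, ‖ζ‖ = 1 → |f ζ - (P.eval ζ).re| < ε := by
  let F : C(AddCircle (1 : ℝ), ℂ) :=
    ⟨fun x => (f (AddCircle.toCircle x) : ℂ), by
      refine Complex.continuous_ofReal.comp ?_
      exact hf.comp_continuous
        (continuous_subtype_val.comp AddCircle.continuous_toCircle) fun x => by
          rw [mem_sphere_zero_iff_norm]; exact Circle.norm_coe _⟩
  have hF : F ∈ (Submodule.span ℂ (range (@fourier (1 : ℝ)))).topologicalClosure := by
    rw [span_fourier_closure_eq_top]; trivial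
  have hF' : F ∈ closure (Submodule.span ℂ (range (@fourier (1 : ℝ))) :
      Set C(AddCircle (1 : ℝ), ℂ)) := hF
  obtain ⟨g, hg, hFg⟩ := Metric.mem_closure_iff.1 hF' ε hε
  have key : ∃ P Q : Polynomial ℂ, ∀ x, g x = P.eval ((AddCircle.toCircle x : Circle) : ℂ) +
      (starRingEnd ℂ) (Q.eval ((AddCircle.toCircle x : Circle) : ℂ)) := by
    clear hFg
    induction hg using Submodule.span_induction with
    | mem g hg =>
      obtain ⟨n, rfl⟩ := hg
      obtain ⟨m, rfl | rfl⟩ := n.eq_nat_or_neg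
      · refine ⟨Polynomial.X ^ m, 0, fun x => ?_⟩
        simp [AddCircle.toCircle_nsmul]
      · refine ⟨0, Polynomial.X ^ m, fun x => ?_⟩
        rw [fourier_neg]
        simp [AddCircle.toCircle_nsmul]
    | zero => exact ⟨0, 0, fun x => by simp⟩
    | add g h _ _ hg hh =>
      obtain ⟨P, Q, hPQ⟩ := hg
      obtain ⟨P', Q', hPQ'⟩ := hh
      refine ⟨P + P', Q + Q', fun x => ?_⟩
      simp [hPQ, hPQ']
      ring
    | smul c g _ hg =>
      obtain ⟨P, Q, hPQ⟩ := hg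
      refine ⟨Polynomial.C c * P, Polynomial.C ((starRingEnd ℂ) c) * Q, fun x => ?_⟩
      simp [hPQ]
      ring
  obtain ⟨P, Q, hPQ⟩ := key
  refine ⟨P + Q, fun ζ hζ => ?_⟩
  obtain ⟨x, hx⟩ := (AddCircle.homeomorphCircle (one_ne_zero (α := ℝ))).surjective
    (⟨ζ, by simpa [Submonoid.unitSphere] using hζ⟩ : Circle)
  have hx' : ((AddCircle.toCircle x : Circle) : ℂ) = ζ := by
    rw [← AddCircle.homeomorphCircle_apply one_ne_zero, hx]
  have h1 : ‖F x - g x‖ < ε := by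
    rw [← dist_eq_norm]; exact (ContinuousMap.dist_apply_le_dist x).trans_lt hFg
  have h2 : F x - g x = (f ζ : ℂ) - (P.eval ζ + (starRingEnd ℂ) (Q.eval ζ)) := by
    rw [hPQ, hx']; simp [F, hx']
  rw [h2] at h1
  refine (le_of_eq ?_).trans_lt ((Complex.abs_re_le_norm _).trans_lt h1)
  simp

theorem exists_eq_on_circle_of_le_circleAverage {g : ℂ → ℝ} {a : ℂ} {r M : ℝ}
    (hg : ContinuousOn g (Metric.sphere a |r|)) (hle : ∀ z ∈ Metric.sphere a |r|, g z ≤ M)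
    (hM : M ≤ Real.circleAverage g a r) : ∀ z ∈ Metric.sphere a |r|, g z = M := by
  intro z hz
  by_contra hne
  have hlt : g z < M := lt_of_le_of_ne (hle z hz) hne
  have hc : Continuous fun θ : ℝ => g (circleMap a r θ) :=
    hg.comp_continuous (continuous_circleMap a r) (circleMap_mem_sphere' a r)
  have hz' := hz
  rw [← image_circleMap_Ioc] at hz'
  obtain ⟨θ, hθ, rfl⟩ := hz'
  have := intervalIntegral.integral_lt_integral_of_continuousOn_of_le_of_exists_lt
    Real.two_pi_pos hc.continuousOn (continuousOn_const (c := M))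
    (fun x _ => hle _ (circleMap_mem_sphere' a r x)) ⟨θ, Ioc_subset_Icc_self hθ, hlt⟩
  rw [Real.circleAverage_def] at hM
  simp only [intervalIntegral.integral_const, smul_eq_mul, sub_zero] at this hM
  have h2 : (2 * Real.pi)⁻¹ * ∫ θ in (0 : ℝ)..2 * Real.pi, g (circleMap a r θ) < M := by
    rw [inv_mul_lt_iff₀ Real.two_pi_pos]; exact this
  linarith

/-- Maximum principle for continuous functions with the local sub-mean value property. -/
theorem le_of_local_submean {g : ℂ → ℝ} {C : ℝ} (hg : ContinuousOn g (Metric.closedBall 0 1))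
    (hloc : ∀ a ∈ Metric.ball (0 : ℂ) 1, ∃ ε > 0, ∀ r, 0 < r → r < ε →
      g a ≤ Real.circleAverage g a r)
    (hC : ∀ z ∈ Metric.sphere (0 : ℂ) 1, g z ≤ C) :
    ∀ z ∈ Metric.closedBall (0 : ℂ) 1, g z ≤ C := by
  obtain ⟨b, hb, hbmax⟩ := (isCompact_closedBall (0 : ℂ) 1).exists_isMaxOn ⟨0, by simp⟩ hg
  suffices g b ≤ C from fun z hz => (hbmax hz).trans this
  by_contra! hlt
  have hKc : IsCompact (Metric.closedBall (0 : ℂ) 1 ∩ g ⁻¹' {g b}) :=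
    (isCompact_closedBall _ _).of_isClosed_subset
      (hg.preimage_isClosed_of_isClosed Metric.isClosed_closedBall isClosed_singleton)
      inter_subset_left
  -- Among the maximum points, take one farthest from the origin: a small circle about it consists
  -- of maximum points, yet reaches farther out.
  obtain ⟨a, ⟨ha, hab⟩, hamax⟩ := hKc.exists_isMaxOn ⟨b, hb, rfl⟩ continuous_norm.continuousOn
  have hab : g a = g b := hab
  have ha1 : ‖a‖ < 1 := by
    refine lt_of_le_of_ne (by simpa using ha) fun h => ?_
    have := hC a (by simpa using h)
    linarith
  obtain ⟨ε, hε, h⟩ := hloc a (by simpa using ha1)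
  obtain ⟨r, hr0, hr⟩ : ∃ r, 0 < r ∧ r < min ε (1 - ‖a‖) := exists_between (by
    simp [hε, ha1])
  have hrε : r < ε := hr.trans_le (min_le_left _ _)
  have hr1 : r < 1 - ‖a‖ := hr.trans_le (min_le_right _ _)
  have hsub : Metric.sphere a |r| ⊆ Metric.closedBall (0 : ℂ) 1 := by
    intro z hz
    rw [abs_of_pos hr0, mem_sphere_iff_norm] at hz
    have := norm_le_norm_add_norm_sub' z a
    simp only [Metric.mem_closedBall, dist_zero_right]
    linarith
  have heq := exists_eq_on_circle_of_le_circleAverage (hg.mono hsub)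
    (fun z hz => hbmax (hsub hz)) (hab ▸ h r hr0 hrε)
  obtain ⟨u, hu, hau⟩ : ∃ u : ℂ, ‖u‖ = 1 ∧ ‖a + r * u‖ = ‖a‖ + r := by
    by_cases h0 : a = 0
    · exact ⟨1, by simp, by simp [h0, abs_of_pos hr0]⟩
    · have h0' : ‖a‖ ≠ 0 := norm_ne_zero_iff.2 h0
      refine ⟨a / ‖a‖, by simp [h0'], ?_⟩
      have : a + r * (a / ‖a‖) = ((‖a‖ + r : ℝ) : ℂ) * (a / ‖a‖) := by
        have : (‖a‖ : ℂ) ≠ 0 := by exact_mod_cast h0'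
        push_cast; field_simp
      rw [this, norm_mul, Complex.norm_real, Real.norm_of_nonneg (by positivity)]
      simp [h0']
  have hmem : a + r * u ∈ Metric.sphere a |r| := by simp [hu]
  have := hamax ⟨hsub hmem, heq _ hmem⟩
  simp only [mem_ofPred_eq, hau] at this
  linarith

theorem continuousOn_circleIntegrable_of_subset {f : ℂ → ℝ} {s : Set ℂ} (hf : ContinuousOn f s)
    {a : ℂ} {r : ℝ} (h : Metric.sphere a |r| ⊆ s) : CircleIntegrable f a r :=
  (hf.mono h).circleIntegrable'

/-- The local sub-mean value property implies the one for the unit circle. -/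
theorem submean_of_local_submean {f : ℂ → ℝ} (hf : ContinuousOn f (Metric.closedBall 0 1))
    (hloc : ∀ a ∈ Metric.ball (0 : ℂ) 1, ∃ ε > 0, ∀ r, 0 < r → r < ε →
      f a ≤ Real.circleAverage f a r) :
    f 0 ≤ Real.circleAverage f 0 1 := by
  refine le_of_forall_pos_le_add fun ε hε => ?_
  obtain ⟨P, hP⟩ := exists_polynomial_re_approx (hf.mono Metric.sphere_subset_closedBall)
    (half_pos hε)
  have hPc : Continuous fun ζ : ℂ => (P.eval ζ).re :=
    Complex.continuous_re.comp P.continuous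
  have hPavg : ∀ (a : ℂ) (r : ℝ), Real.circleAverage (fun ζ : ℂ => (P.eval ζ).re) a r =
      (P.eval a).re := by
    intro a r
    have h1 : Real.circleAverage (fun ζ : ℂ => P.eval ζ) a r = P.eval a :=
      (P.differentiable.diffContOnCl).circleAverage
    have h2 := Complex.reCLM.circleAverage_comp_comm (f := fun ζ : ℂ => P.eval ζ) (c := a) (R := r)
      (P.continuous.continuousOn.circleIntegrable')
    rw [h1] at h2
    exact h2
  have hPi : ∀ (a : ℂ) (r : ℝ), CircleIntegrable (fun ζ : ℂ => (P.eval ζ).re) a r :=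
    fun a r => hPc.continuousOn.circleIntegrable'
  -- `Re P` is harmonic, so `f - Re P` keeps the local sub-mean property and is at most `ε / 2` on
  -- the circle, hence at the centre.
  have hmax := le_of_local_submean (g := fun ζ => f ζ - (P.eval ζ).re) (C := ε / 2)
    (hf.sub hPc.continuousOn) (fun a ha => by
      obtain ⟨ε', hε', h⟩ := hloc a ha
      have ha1 : ‖a‖ < 1 := by simpa using ha
      refine ⟨min ε' (1 - ‖a‖), by simp [hε', ha1], fun r hr0 hr => ?_⟩
      rw [Real.circleAverage_fun_sub _ (hPi a r), hPavg]
      · have := h r hr0 (hr.trans_le (min_le_left _ _))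
        linarith
      · refine continuousOn_circleIntegrable_of_subset hf fun z hz => ?_
        rw [abs_of_pos hr0, mem_sphere_iff_norm] at hz
        have := norm_le_norm_add_norm_sub' z a
        have := hr.trans_le (min_le_right _ _)
        simp only [Metric.mem_closedBall, dist_zero_right]
        linarith)
    (fun z hz => (abs_lt.1 (hP z (by simpa using hz))).2.le) 0 (by simp)
  have hint : CircleIntegrable f 0 1 := continuousOn_circleIntegrable_of_subset hf
    (by simpa using Metric.sphere_subset_closedBall)
  have h1 : Real.circleAverage (fun ζ : ℂ => (P.eval ζ).re - ε / 2) 0 1 ≤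
      Real.circleAverage f 0 1 := by
    refine Real.circleAverage_mono ((hPc.sub continuous_const).continuousOn.circleIntegrable')
      hint fun z hz => ?_
    have := (abs_lt.1 (hP z (by simpa using hz))).1
    linarith
  rw [Real.circleAverage_fun_sub (hPi 0 1) (continuousOn_const.circleIntegrable'), hPavg,
    Real.circleAverage_const] at h1
  linarith

/-- A continuous function which is locally touched from below by continuous plurisubharmonic
functions is plurisubharmonic. -/
theorem IsPSHOn.of_local_touch {n : ℕ} {Ω : Set (EuclideanSpace ℂ (Fin n))}
    {f : EuclideanSpace ℂ (Fin n) → ℝ} (hf : ContinuousOn f Ω)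
    (h : ∀ p ∈ Ω, ∃ u : EuclideanSpace ℂ (Fin n) → ℝ,
      IsPSHOn u Ω ∧ u p = f p ∧ ∀ᶠ q in nhds p, u q ≤ f q) :
    IsPSHOn f Ω := by
  refine ⟨hf.upperSemicontinuousOn, fun z w hzw => ?_⟩
  have hcont : ContinuousOn (fun ζ : ℂ => f (z + ζ • w)) (Metric.closedBall 0 1) :=
    hf.comp (by fun_prop) fun ζ hζ => hzw ζ (by simpa using hζ)
  refine ⟨continuousOn_circleIntegrable_of_subset hcont
    (by simpa using Metric.sphere_subset_closedBall), ?_⟩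
  have := submean_of_local_submean hcont fun a ha => ?_
  · simpa using this
  have ha1 : ‖a‖ < 1 := by simpa using ha
  obtain ⟨u, hu, hup, hule⟩ := h (z + a • w) (hzw a ha1.le)
  have hev : ∀ᶠ ζ : ℂ in nhds a, u (z + ζ • w) ≤ f (z + ζ • w) :=
    (show Continuous fun ζ : ℂ => z + ζ • w by fun_prop).continuousAt.eventually hule
  obtain ⟨ε, hε, hball⟩ := Metric.eventually_nhds_iff.1 hev
  refine ⟨min ε (1 - ‖a‖), by simp [hε, ha1], fun r hr0 hr => ?_⟩
  have hrε := hr.trans_le (min_le_left _ _)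
  have hr1 := hr.trans_le (min_le_right _ _)
  have hdisc : ∀ ζ : ℂ, ‖ζ‖ ≤ 1 → ‖(r : ℂ) * ζ + a‖ ≤ 1 := fun ζ hζ => by
    have h1 := norm_add_le ((r : ℂ) * ζ) a
    have h2 : ‖(r : ℂ) * ζ‖ ≤ r := by
      rw [norm_mul, Complex.norm_real, Real.norm_of_nonneg hr0.le]
      exact mul_le_of_le_one_right hr0.le hζ
    linarith
  have hre : ∀ ζ : ℂ, z + a • w + ζ • ((r : ℂ) • w) = z + ((r : ℂ) * ζ + a) • w := fun ζ => by
    module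
  obtain ⟨hi, hle⟩ := hu.2 (z + a • w) ((r : ℂ) • w) fun ζ hζ => by
    rw [hre]; exact hzw _ (hdisc ζ hζ)
  -- On small circles about the touching point, `f = u ≤ mean of u ≤ mean of f`.
  rw [← hup]
  refine hle.trans ?_
  simp only [hre] at hi ⊢
  rw [Real.circleAverage_eq_circleAverage_zero_one (c := a)]
  refine Real.circleAverage_mono hi ?_ fun ζ hζ => ?_
  · refine continuousOn_circleIntegrable_of_subset (s := Metric.closedBall 0 1) ?_
      (by simpa using Metric.sphere_subset_closedBall)
    exact hcont.comp (by fun_prop) fun ζ hζ => by simpa using hdisc ζ (by simpa using hζ)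
  · refine hball ?_
    have hζ1 : ‖ζ‖ = 1 := by simpa using hζ
    rw [dist_eq_norm, add_sub_cancel_right, norm_mul, Complex.norm_real,
      Real.norm_of_nonneg hr0.le, hζ1, mul_one]
    exact hrε

/-! ### Boundary distances of nested domains; operations on plurisubharmonic functions. -/

theorem continuous_boundaryDist {n : ℕ} (Ω : Set (EuclideanSpace ℂ (Fin n))) :
    Continuous (boundaryDist Ω) :=
  Metric.continuous_infDist_pt _

theorem boundaryDist_pos {n : ℕ} {Ω : Set (EuclideanSpace ℂ (Fin n))} (hΩ : IsOpen Ω)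
    (hne : (frontier Ω).Nonempty) {z : EuclideanSpace ℂ (Fin n)} (hz : z ∈ Ω) :
    0 < boundaryDist Ω z := by
  refine (isClosed_frontier.notMem_iff_infDist_pos hne).1 fun h => ?_
  rw [hΩ.frontier_eq] at h
  exact h.2 hz

theorem IsPreconnected.inter_frontier_nonempty' {X : Type*} [TopologicalSpace X] {s A : Set X}
    (hs : IsPreconnected s) (h1 : (s ∩ A).Nonempty) (h2 : (s ∩ Aᶜ).Nonempty) :
    (s ∩ frontier A).Nonempty := by
  by_contra hne
  rw [not_nonempty_iff_eq_empty, ← disjoint_iff_inter_eq_empty] at hne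
  have hcov : s ⊆ interior A ∪ interior Aᶜ := by
    intro x hx
    have hx' := disjoint_left.1 hne hx
    by_cases hi : x ∈ interior A
    · exact Or.inl hi
    · right
      rw [interior_compl]
      exact fun hc => hx' ⟨hc, hi⟩
  obtain ⟨x, hx, hxA⟩ := h1
  obtain ⟨y, hy, hyA⟩ := h2
  obtain ⟨z, -, hz1, hz2⟩ := hs _ _ isOpen_interior isOpen_interior hcov
    ⟨x, hx, (hcov hx).resolve_right fun h => interior_subset h hxA⟩
    ⟨y, hy, (hcov hy).resolve_left fun h => hyA (interior_subset h)⟩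
  exact interior_subset hz2 (interior_subset hz1)

/-- The segment from `z` to a nearest point `p` of `∂D` leaves `Ω` through some `q ∈ ∂Ω`, and `|z -
p| = |z - q| + |q - p|`. -/
theorem boundaryDist_add_le {n : ℕ} {Ω D : Set (EuclideanSpace ℂ (Fin n))} (hD : IsOpen D)
    (hsub : closure Ω ⊆ D) (hne : (frontier D).Nonempty) {c : ℝ}
    (hc : ∀ q ∈ frontier Ω, c ≤ boundaryDist D q) {z : EuclideanSpace ℂ (Fin n)} (hz : z ∈ Ω) :
    boundaryDist Ω z + c ≤ boundaryDist D z := by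
  obtain ⟨p, hp, hpz⟩ := isClosed_frontier.exists_infDist_eq_dist hne z
  have hpΩ : p ∉ Ω := fun h => by
    rw [hD.frontier_eq] at hp
    exact hp.2 (hsub (subset_closure h))
  obtain ⟨q, hqs, hq⟩ := ((convex_segment (𝕜 := ℝ) z p).isPreconnected).inter_frontier_nonempty'
    (A := Ω) ⟨z, left_mem_segment ℝ z p, hz⟩ ⟨p, right_mem_segment ℝ z p, hpΩ⟩
  have h1 := dist_add_dist_of_mem_segment hqs
  have h2 : boundaryDist Ω z ≤ dist z q := Metric.infDist_le_dist_of_mem hq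
  have h3 : boundaryDist D q ≤ dist q p := Metric.infDist_le_dist_of_mem hp
  have h4 := hc q hq
  have h5 : boundaryDist D z = dist z p := hpz
  linarith

theorem boundaryDist_le_add {n : ℕ} {Ω D : Set (EuclideanSpace ℂ (Fin n))}
    (hne : (frontier Ω).Nonempty) {t : ℝ} (ht : ∀ q ∈ frontier Ω, boundaryDist D q ≤ t)
    (z : EuclideanSpace ℂ (Fin n)) : boundaryDist D z ≤ boundaryDist Ω z + t := by
  obtain ⟨q, hq, hqz⟩ := isClosed_frontier.exists_infDist_eq_dist hne z
  have h1 : boundaryDist D z ≤ boundaryDist D q + dist z q := Metric.infDist_le_infDist_add_dist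
  have h2 := ht q hq
  have h3 : boundaryDist Ω z = dist z q := hqz
  linarith

theorem IsPSHOn.mono {n : ℕ} {Ω D : Set (EuclideanSpace ℂ (Fin n))}
    {u : EuclideanSpace ℂ (Fin n) → ℝ} (hu : IsPSHOn u D) (h : Ω ⊆ D) : IsPSHOn u Ω :=
  ⟨hu.1.mono h, fun z w hzw => hu.2 z w fun ζ hζ => h (hzw ζ hζ)⟩

theorem IsPSHOn.mul_add_const {n : ℕ} {Ω : Set (EuclideanSpace ℂ (Fin n))}
    {u : EuclideanSpace ℂ (Fin n) → ℝ} (hu : IsPSHOn u Ω) (hc : ContinuousOn u Ω) {a : ℝ}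
    (ha : 0 ≤ a) (b : ℝ) : IsPSHOn (fun z => a * (u z + b)) Ω := by
  refine ⟨(continuousOn_const.mul (hc.add continuousOn_const)).upperSemicontinuousOn,
    fun z w hzw => ?_⟩
  obtain ⟨hi, hle⟩ := hu.2 z w hzw
  have hib := hi.add (circleIntegrable_const b 0 1)
  refine ⟨hib.const_fun_smul (a := a), ?_⟩
  have h1 : Real.circleAverage (fun ζ : ℂ => a * (u (z + ζ • w) + b)) 0 1 =
      a * (Real.circleAverage (fun ζ : ℂ => u (z + ζ • w)) 0 1 + b) := by
    have := Real.circleAverage_fun_smul (a := a) (f := fun ζ : ℂ => u (z + ζ • w) + b)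
      (c := 0) (R := 1)
    simp only [smul_eq_mul] at this
    rw [this, Real.circleAverage_fun_add hi (circleIntegrable_const b 0 1),
      Real.circleAverage_const]
  simp only [h1]
  exact mul_le_mul_of_nonneg_left (by linarith) ha

theorem isPSHOn_const {n : ℕ} (Ω : Set (EuclideanSpace ℂ (Fin n))) (c : ℝ) :
    IsPSHOn (fun _ => c) Ω :=
  ⟨continuousOn_const.upperSemicontinuousOn, fun _ _ _ =>
    ⟨circleIntegrable_const c 0 1, (Real.circleAverage_const c 0 1).ge⟩⟩

/-! ### Gluing of the barriers. -/

/-- Successive gluing of the barriers `w k` near the boundary, starting from `-1`. -/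
noncomputable def gluedBarrier {n : ℕ} (Ω : Set (EuclideanSpace ℂ (Fin n))) (r : ℕ → ℝ)
    (w : ℕ → EuclideanSpace ℂ (Fin n) → ℝ) : ℕ → EuclideanSpace ℂ (Fin n) → ℝ
  | 0 => fun _ => -1
  | k + 1 => fun z => if r k ≤ boundaryDist Ω z then gluedBarrier Ω r w k z
      else max (gluedBarrier Ω r w k z) (w k z)

section gluedBarrier

variable {n : ℕ} {Ω : Set (EuclideanSpace ℂ (Fin n))} {r M : ℕ → ℝ}
  {w : ℕ → EuclideanSpace ℂ (Fin n) → ℝ}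

theorem gluedBarrier_succ (k : ℕ) (z : EuclideanSpace ℂ (Fin n)) :
    gluedBarrier Ω r w (k + 1) z = if r k ≤ boundaryDist Ω z then gluedBarrier Ω r w k z
      else max (gluedBarrier Ω r w k z) (w k z) := rfl

theorem gluedBarrier_le_succ (k : ℕ) (z : EuclideanSpace ℂ (Fin n)) :
    gluedBarrier Ω r w k z ≤ gluedBarrier Ω r w (k + 1) z := by
  rw [gluedBarrier_succ]
  split_ifs
  · exact le_rfl
  · exact le_max_left _ _

theorem gluedBarrier_eq_of_le (hr : Antitone r) {k m : ℕ} (hkm : k ≤ m)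
    {z : EuclideanSpace ℂ (Fin n)} (hz : r k ≤ boundaryDist Ω z) :
    gluedBarrier Ω r w m z = gluedBarrier Ω r w k z := by
  induction m, hkm using Nat.le_induction with
  | base => rfl
  | succ m hm ih => rw [gluedBarrier_succ, if_pos ((hr hm).trans hz), ih]

theorem gluedBarrier_neg (hw : ∀ k, ∀ z ∈ Ω, w k z < 0) (k : ℕ) :
    ∀ z ∈ Ω, gluedBarrier Ω r w k z < 0 := by
  induction k with
  | zero => intro z _; simp [gluedBarrier]
  | succ k ih =>
    intro z hz
    rw [gluedBarrier_succ]
    split_ifs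
    · exact ih z hz
    · exact max_lt (ih z hz) (hw k z hz)

/-- This makes the next gluing seamless: on `δ_Ω = r k` the new barrier satisfies `w k ≤ -M k`, so
it does not exceed the function already built. -/
theorem neg_le_gluedBarrier (hr : Antitone r) (hM : M 0 = 1)
    (hlow : ∀ k, ∀ z ∈ Ω, boundaryDist Ω z ≤ r (k + 1) → -M (k + 1) ≤ w k z)
    (hup : ∀ k, ∀ z ∈ Ω, r k ≤ boundaryDist Ω z → w k z ≤ -M k) (k : ℕ) :
    ∀ z ∈ Ω, boundaryDist Ω z ≤ r k → -M k ≤ gluedBarrier Ω r w k z := by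
  induction k with
  | zero => intro z _ _; simp [gluedBarrier, hM]
  | succ k ih =>
    intro z hz hzr
    have hzk : boundaryDist Ω z ≤ r k := hzr.trans (hr k.le_succ)
    rw [gluedBarrier_succ]
    split_ifs with h
    -- Degenerate case `boundaryDist Ω z = r k = r (k + 1)`, possible since `r` is only assumed
    -- antitone.
    · exact (hlow k z hz hzr).trans ((hup k z hz h).trans (ih z hz hzk))
    · exact (hlow k z hz hzr).trans (le_max_right _ _)

theorem continuousOn_gluedBarrier (hr : Antitone r) (hM : M 0 = 1)
    (hlow : ∀ k, ∀ z ∈ Ω, boundaryDist Ω z ≤ r (k + 1) → -M (k + 1) ≤ w k z)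
    (hup : ∀ k, ∀ z ∈ Ω, r k ≤ boundaryDist Ω z → w k z ≤ -M k)
    (hwc : ∀ k, ContinuousOn (w k) Ω) (k : ℕ) : ContinuousOn (gluedBarrier Ω r w k) Ω := by
  induction k with
  | zero => exact continuousOn_const
  | succ k ih =>
    have hwk := hwc k
    rw [continuousOn_iff_continuous_domRestrict] at ih hwk ⊢
    refine Continuous.if_le ih (ih.max hwk) continuous_const
      ((continuous_boundaryDist Ω).comp continuous_subtype_val) fun z hz => ?_
    refine (max_eq_left ?_).symm
    exact (hup k z z.2 hz.le).trans (neg_le_gluedBarrier hr hM hlow hup k z z.2 hz.ge)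

/-- At each point the new function is touched from below either by the previous stage, which it
dominates everywhere, or by `w k` in the open region `δ_Ω < r k`. -/
theorem isPSHOn_gluedBarrier (hr : Antitone r) (hM : M 0 = 1)
    (hlow : ∀ k, ∀ z ∈ Ω, boundaryDist Ω z ≤ r (k + 1) → -M (k + 1) ≤ w k z)
    (hup : ∀ k, ∀ z ∈ Ω, r k ≤ boundaryDist Ω z → w k z ≤ -M k)
    (hwc : ∀ k, ContinuousOn (w k) Ω) (hw : ∀ k, IsPSHOn (w k) Ω) (k : ℕ) :
    IsPSHOn (gluedBarrier Ω r w k) Ω := by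
  induction k with
  | zero => exact isPSHOn_const Ω (-1)
  | succ k ih =>
    refine IsPSHOn.of_local_touch (continuousOn_gluedBarrier hr hM hlow hup hwc (k + 1))
      fun p _ => ?_
    by_cases h : gluedBarrier Ω r w k p = gluedBarrier Ω r w (k + 1) p
    · exact ⟨_, ih, h, Filter.Eventually.of_forall (gluedBarrier_le_succ k)⟩
    · have hp : ¬ r k ≤ boundaryDist Ω p := fun hp => h (by rw [gluedBarrier_succ, if_pos hp])
      refine ⟨w k, hw k, ?_, ?_⟩
      · rw [gluedBarrier_succ, if_neg hp] at h ⊢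
        rcases max_choice (gluedBarrier Ω r w k p) (w k p) with h' | h'
        · exact absurd h'.symm h
        · exact h'.symm
      · filter_upwards [(continuous_boundaryDist Ω).continuousAt.eventually_lt_const
          (not_le.1 hp)] with q hq
        rw [gluedBarrier_succ, if_neg (not_le.2 hq)]
        exact le_max_right _ _

end gluedBarrier

/-- A bounded domain with a sequence of plurisubharmonic barriers at scales `r k → 0`, which improve
the lower bound `-M k` near the boundary to `-M (k + 1)`, with `M k → 0`, is hyperconvex. -/
theorem isHyperconvexDomain_of_barriers {n : ℕ} {Ω : Set (EuclideanSpace ℂ (Fin n))}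
    (hΩo : IsOpen Ω) (hΩc : IsConnected Ω) (hΩb : Bornology.IsBounded Ω)
    (hne : (frontier Ω).Nonempty) {r M : ℕ → ℝ} (hr : Antitone r) (hr_pos : ∀ k, 0 < r k)
    (hr0 : Filter.Tendsto r Filter.atTop (nhds 0)) (hM : M 0 = 1)
    (hM0 : Filter.Tendsto M Filter.atTop (nhds 0))
    {w : ℕ → EuclideanSpace ℂ (Fin n) → ℝ}
    (hlow : ∀ k, ∀ z ∈ Ω, boundaryDist Ω z ≤ r (k + 1) → -M (k + 1) ≤ w k z)
    (hup : ∀ k, ∀ z ∈ Ω, r k ≤ boundaryDist Ω z → w k z ≤ -M k)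
    (hwc : ∀ k, ContinuousOn (w k) Ω) (hw : ∀ k, IsPSHOn (w k) Ω)
    (hw_neg : ∀ k, ∀ z ∈ Ω, w k z < 0) : IsHyperconvexDomain Ω := by
  have hex : ∀ z ∈ Ω, ∃ k, r k < boundaryDist Ω z := fun z hz =>
    (hr0.eventually_lt_const (boundaryDist_pos hΩo hne hz)).exists
  choose! N hN using hex
  set ρ : EuclideanSpace ℂ (Fin n) → ℝ := fun z => gluedBarrier Ω r w (N z) z
  have hρ : ∀ k, ∀ z ∈ Ω, r k ≤ boundaryDist Ω z → ρ z = gluedBarrier Ω r w k z := by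
    intro k z hz hk
    rw [← gluedBarrier_eq_of_le hr (le_max_left k (N z)) hk,
      gluedBarrier_eq_of_le hr (le_max_right k (N z)) (hN z hz).le]
  have hev : ∀ z ∈ Ω, ∀ᶠ q in nhds z, ρ q = gluedBarrier Ω r w (N z) q := by
    intro z hz
    filter_upwards [hΩo.mem_nhds hz, (continuous_boundaryDist Ω).continuousAt.eventually_const_lt
      (hN z hz)] with q hq hq'
    exact hρ _ q hq hq'.le
  have hcont : ContinuousOn ρ Ω := fun z hz =>
    (((continuousOn_gluedBarrier hr hM hlow hup hwc (N z)).continuousAt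
      (hΩo.mem_nhds hz)).congr (Filter.EventuallyEq.symm (hev z hz))).continuousWithinAt
  refine ⟨hΩo, hΩc, hΩb, ρ, fun z hz => gluedBarrier_neg hw_neg _ z hz, hcont, ?_, ?_⟩
  · refine IsPSHOn.of_local_touch hcont fun p hp =>
      ⟨_, isPSHOn_gluedBarrier hr hM hlow hup hwc hw (N p), rfl, ?_⟩
    filter_upwards [hev p hp] with q hq
    exact hq.ge
  · intro c hc
    have hsub : {z | z ∈ Ω ∧ ρ z < -c} ⊆ Ω := fun z hz => hz.1
    refine ⟨(hΩb.subset hsub).isCompact_closure, ?_⟩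
    obtain ⟨k, hk⟩ := (hM0.eventually_lt_const hc).exists
    -- Once `M k < c`, the bound `-M k ≤ ρ` on `δ_Ω ≤ r k` keeps the sublevel set away from the
    -- boundary.
    have hfar : {z | z ∈ Ω ∧ ρ z < -c} ⊆ {z | r k ≤ boundaryDist Ω z} := by
      rintro z ⟨hz, hzc⟩
      by_contra hlt
      have h1 := neg_le_gluedBarrier hr hM hlow hup k z hz (not_le.1 hlt).le
      have h2 : gluedBarrier Ω r w k z ≤ ρ z := by
        rw [hρ (max k (N z)) z hz ((hr (le_max_right _ _)).trans (hN z hz).le)]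
        exact monotone_nat_of_le_succ (f := fun j => gluedBarrier Ω r w j z)
          (fun j => gluedBarrier_le_succ j z) (le_max_left _ _)
      linarith
    intro z hz
    have h1 : r k ≤ boundaryDist Ω z :=
      closure_minimal hfar (isClosed_le continuous_const (continuous_boundaryDist Ω)) hz
    by_contra hzΩ
    have h2 : z ∈ frontier Ω := by
      rw [hΩo.frontier_eq]; exact ⟨closure_mono hsub hz, hzΩ⟩
    have h3 : boundaryDist Ω z = 0 := Metric.infDist_zero_of_mem h2
    linarith [hr_pos k]

/-- Such an `Ω` is the whole space, so boundedness leaves only `n = 0`; a constant suffices. -/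
theorem isHyperconvexDomain_of_frontier_eq_empty {n : ℕ} {Ω : Set (EuclideanSpace ℂ (Fin n))}
    (hΩo : IsOpen Ω) (hΩc : IsConnected Ω) (hΩb : Bornology.IsBounded Ω)
    (he : frontier Ω = ∅) : IsHyperconvexDomain Ω := by
  refine ⟨hΩo, hΩc, hΩb, fun _ => -1, fun _ _ => by norm_num, continuousOn_const,
    isPSHOn_const Ω (-1), fun c _ => ?_⟩
  have hsub : {z | z ∈ Ω ∧ (-1 : ℝ) < -c} ⊆ Ω := fun z hz => hz.1
  refine ⟨(hΩb.subset hsub).isCompact_closure, (closure_mono hsub).trans ?_⟩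
  rw [closure_eq_self_union_frontier, he, union_empty]

/-! ### From the divergent integral to a vanishing product. -/

/-- The dyadic-type discretization of the divergence of `∫ dt / (t log (t / η t))` at `0`. -/
theorem not_summable_of_lintegral_eq_top {t₀ : ℝ} {η : ℝ → ℝ}
    (hη_pos : ∀ t ∈ Ioc 0 t₀, 0 < η t) (hη_mono : MonotoneOn η (Ioc 0 t₀))
    (hη_le : ∀ t ∈ Ioc 0 t₀, η t ≤ t)
    (hdiv : ∀ r ∈ Ioc 0 t₀,
      ∫⁻ t in Ioo 0 r, (ENNReal.ofReal (t * Real.log (t / η t)))⁻¹ = ⊤)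
    {r : ℕ → ℝ} (hr : ∀ k, r k ∈ Ioc 0 t₀) (hr4 : ∀ k, r k = 4 * r (k + 1))
    (hr0 : Filter.Tendsto r Filter.atTop (nhds 0)) :
    ¬ Summable fun k => Real.log 2 / Real.log (5 * r k / η (r k)) := by
  intro hs
  set κ : ℕ → ℝ := fun k => Real.log 2 / Real.log (5 * r k / η (r k)) with hκ
  have hl2 : 0 < Real.log 2 := Real.log_pos one_lt_two
  have hl5 : 0 < Real.log 5 := Real.log_pos (by norm_num)
  have hx : ∀ k, 0 ≤ Real.log (r k / η (r k)) := fun k =>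
    Real.log_nonneg ((one_le_div (hη_pos _ (hr k))).2 (hη_le _ (hr k)))
  have hlog : ∀ k, Real.log (5 * r k / η (r k)) = Real.log 5 + Real.log (r k / η (r k)) :=
    fun k => by
      rw [mul_div_assoc, Real.log_mul (by norm_num)
        (div_pos (hr k).1 (hη_pos _ (hr k))).ne']
  have hκpos : ∀ k, 0 < κ k := fun k => by
    simp only [hκ, hlog]; exact div_pos hl2 (by linarith [hx k])
  -- The threshold makes `log (5 * r k / η (r k))` exceed `2 * (log 4 + log 5)`, so subtracting `log
  -- 4 + log 5` below costs at most half of it.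
  have hsmall : ∀ᶠ k in Filter.atTop, κ k < Real.log 2 / (2 * (Real.log 4 + Real.log 5)) :=
    hs.tendsto_atTop_zero.eventually_lt_const (by
      have : 0 < Real.log 4 := Real.log_pos (by norm_num)
      positivity)
  obtain ⟨K, hK⟩ := Filter.eventually_atTop.1 hsmall
  have hpiece : ∀ k, K ≤ k →
      ∫⁻ t in Ico (r (k + 1)) (r k), (ENNReal.ofReal (t * Real.log (t / η t)))⁻¹ ≤
        ENNReal.ofReal (6 / Real.log 2 * κ k) := by
    intro k hk
    have hr1 := (hr (k + 1)).1
    have hκk := hκpos k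
    have hbound : ∀ t ∈ Ico (r (k + 1)) (r k), (ENNReal.ofReal (t * Real.log (t / η t)))⁻¹ ≤
        ENNReal.ofReal (2 * κ k / (Real.log 2 * r (k + 1))) := by
      rintro t ⟨ht1, ht2⟩
      have ht0 : 0 < t := hr1.trans_le ht1
      have htm : t ∈ Ioc 0 t₀ := ⟨ht0, ht2.le.trans (hr k).2⟩
      -- Monotonicity of `η` bounds `t / η t` on the whole interval by its data at `r k`, up to the
      -- factor 4.
      have h1 : r k / η (r k) / 4 ≤ t / η t := by
        have : r k / η (r k) / 4 = r (k + 1) / η (r k) := by rw [hr4 k]; ring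
        rw [this]
        exact div_le_div₀ ht0.le ht1 (hη_pos t htm) (hη_mono htm (hr k) ht2.le)
      have hq : 0 < r k / η (r k) := div_pos (hr k).1 (hη_pos _ (hr k))
      have h2 : Real.log (r k / η (r k)) - Real.log 4 ≤ Real.log (t / η t) := by
        rw [← Real.log_div hq.ne' (by norm_num)]
        exact Real.log_le_log (by positivity) h1
      have h3 := hK k hk
      have hl4 : 0 < Real.log 4 := Real.log_pos (by norm_num)
      have h4 : 2 * (Real.log 4 + Real.log 5) < Real.log 5 + Real.log (r k / η (r k)) := by
        simp only [hκ, hlog] at h3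
        rwa [div_lt_div_iff_of_pos_left hl2 (by linarith [hx k]) (by positivity)] at h3
      have h5 : Real.log 2 / (2 * κ k) = (Real.log 5 + Real.log (r k / η (r k))) / 2 := by
        simp only [hκ, hlog]
        have : Real.log 5 + Real.log (r k / η (r k)) ≠ 0 := by linarith [hx k]
        field_simp
      have h6 : Real.log 2 / (2 * κ k) ≤ Real.log (t / η t) := by rw [h5]; linarith
      rw [← ENNReal.ofReal_inv_of_pos (by
        have : 0 < Real.log (t / η t) := lt_of_lt_of_le (by positivity) h6
        positivity)]
      refine ENNReal.ofReal_le_ofReal ?_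
      have h7 : 2 * κ k / (Real.log 2 * r (k + 1)) = (r (k + 1) * (Real.log 2 / (2 * κ k)))⁻¹ := by
        field_simp
      rw [h7]
      gcongr
    calc _ ≤ ∫⁻ _ in Ico (r (k + 1)) (r k),
          ENNReal.ofReal (2 * κ k / (Real.log 2 * r (k + 1))) :=
          setLIntegral_mono' measurableSet_Ico hbound
      -- The interval has length `3 * r (k + 1)`, whence `6 = 2 * 3`.
      _ = ENNReal.ofReal (6 / Real.log 2 * κ k) := by
          rw [setLIntegral_const, Real.volume_Ico, ← ENNReal.ofReal_mul (by positivity)]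
          congr 1
          rw [hr4 k]
          field_simp
          ring
  have hanti : Antitone r := antitone_nat_of_succ_le fun k => by
    have := (hr (k + 1)).1
    rw [hr4 k]; linarith
  have hcover : Ioo 0 (r K) ⊆ ⋃ j, Ico (r (K + j + 1)) (r (K + j)) := by
    rintro t ⟨ht0, htK⟩
    have hex : ∃ m, r m ≤ t := (hr0.eventually_le_const ht0).exists
    classical
    have hm := Nat.find_spec hex
    have hmK : K < Nat.find hex := by
      by_contra h
      exact absurd ((hanti (not_lt.1 h)).trans hm) (not_le.2 htK)
    obtain ⟨j, hj⟩ := Nat.exists_eq_add_of_lt hmK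
    refine mem_iUnion.2 ⟨j, ?_, ?_⟩
    · rw [← hj]; exact hm
    · exact not_le.1 (Nat.find_min hex (by omega))
  have hs' : Summable fun j => 6 / Real.log 2 * κ (K + j) := by
    refine Summable.mul_left _ ?_
    simpa only [add_comm] using (summable_nat_add_iff K).2 hs
  have hfin : ∫⁻ t in Ioo 0 (r K), (ENNReal.ofReal (t * Real.log (t / η t)))⁻¹ < ⊤ :=
    calc _ ≤ ∫⁻ t in ⋃ j, Ico (r (K + j + 1)) (r (K + j)),
          (ENNReal.ofReal (t * Real.log (t / η t)))⁻¹ := lintegral_mono_set hcover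
      _ ≤ ∑' j, ∫⁻ t in Ico (r (K + j + 1)) (r (K + j)),
          (ENNReal.ofReal (t * Real.log (t / η t)))⁻¹ := lintegral_iUnion_le _ _
      _ ≤ ∑' j, ENNReal.ofReal (6 / Real.log 2 * κ (K + j)) :=
          ENNReal.tsum_le_tsum fun j => hpiece (K + j) (Nat.le_add_right _ _)
      _ < ⊤ := hs'.tsum_ofReal_lt_top
  exact hfin.ne (hdiv (r K) (hr K))

/-- Each factor is at most `1 - κ ≤ exp (-κ)`. -/
theorem tendsto_prod_zero_of_not_summable {a κ : ℕ → ℝ} (ha : ∀ k, 0 ≤ a k)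
    (hκ : ∀ k, 0 ≤ κ k) (haκ : ∀ k, a k ≤ 1 - κ k) (hs : ¬ Summable κ) :
    Filter.Tendsto (fun k => ∏ i ∈ Finset.range k, a i) Filter.atTop (nhds 0) := by
  have hb : ∀ k, ∏ i ∈ Finset.range k, a i ≤ Real.exp (-∑ i ∈ Finset.range k, κ i) := by
    intro k
    rw [← Finset.sum_neg_distrib, Real.exp_sum]
    refine Finset.prod_le_prod (fun i _ => ha i) fun i _ => ?_
    have := Real.add_one_le_exp (-κ i)
    linarith [haκ i]
  refine squeeze_zero (fun k => Finset.prod_nonneg fun i _ => ha i) hb ?_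
  exact Real.tendsto_exp_neg_atTop_nhds_zero.comp
    ((not_summable_iff_tendsto_nat_atTop_of_nonneg hκ).1 hs)

/-! ### Construction of the barriers and conclusion. -/

/-- In `hdiv` the integrand is `1 / (t log (t / η t))` with values in `[0, ∞]` and `1 / 0 = ∞`;
the divergence is required on `(0, r)` for arbitrarily small `r`, i.e. at the endpoint `0`. -/
theorem proposition5p1 (n : ℕ) (Ω : Set (EuclideanSpace ℂ (Fin n)))
    (hbdd : Bornology.IsBounded Ω) (hΩ : IsPseudoconvexDomain Ω)
    (t₀ : ℝ) (ht₀ : 0 < t₀) (Ω' : ℝ → Set (EuclideanSpace ℂ (Fin n))) (η : ℝ → ℝ)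
    (hΩ' : ∀ t ∈ Set.Ioc 0 t₀, IsPseudoconvexDomain (Ω' t))
    (hsub : ∀ t ∈ Set.Ioc 0 t₀, closure Ω ⊆ Ω' t)
    (hη_pos : ∀ t ∈ Set.Ioc 0 t₀, 0 < η t)
    (hη_cont : ContinuousOn η (Set.Ioc 0 t₀))
    (hη_mono : MonotoneOn η (Set.Ioc 0 t₀))
    (hdist : ∀ t ∈ Set.Ioc 0 t₀, ∀ z ∈ frontier Ω,
      η t ≤ boundaryDist (Ω' t) z ∧ boundaryDist (Ω' t) z ≤ t)
    (hdiv : ∀ r ∈ Set.Ioc 0 t₀,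
      ∫⁻ t in Set.Ioo 0 r, (ENNReal.ofReal (t * Real.log (t / η t)))⁻¹ = ⊤) :
    IsHyperconvexDomain Ω := by
  obtain ⟨hΩo, hΩc, -⟩ := hΩ
  rcases (frontier Ω).eq_empty_or_nonempty with he | hne
  · exact isHyperconvexDomain_of_frontier_eq_empty hΩo hΩc hbdd he
  have hη_le : ∀ t ∈ Ioc 0 t₀, η t ≤ t := fun t ht => by
    obtain ⟨q, hq⟩ := hne
    exact (hdist t ht q hq).1.trans (hdist t ht q hq).2
  have hne' : ∀ t ∈ Ioc 0 t₀, (frontier (Ω' t)).Nonempty := fun t ht => by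
    obtain ⟨q, hq⟩ := hne
    by_contra h
    have h1 := (hη_pos t ht).trans_le (hdist t ht q hq).1
    rw [boundaryDist, not_nonempty_iff_eq_empty.1 h, Metric.infDist_empty] at h1
    exact h1.false
  have hge : ∀ t ∈ Ioc 0 t₀, ∀ z ∈ Ω, boundaryDist Ω z + η t ≤ boundaryDist (Ω' t) z :=
    fun t ht z hz => boundaryDist_add_le (hΩ' t ht).1 (hsub t ht) (hne' t ht)
      (fun q hq => (hdist t ht q hq).1) hz
  have hle : ∀ t ∈ Ioc 0 t₀, ∀ z, boundaryDist (Ω' t) z ≤ boundaryDist Ω z + t :=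
    fun t ht z => boundaryDist_le_add hne (fun q hq => (hdist t ht q hq).2) z
  -- Ratio 4 beats the upper bound `δ_{Ω^t} ≤ 2t` near the boundary by a factor 2, which yields `A -
  -- B ≥ log 2`.
  set r : ℕ → ℝ := fun k => t₀ * (1 / 4) ^ k with hr_def
  have hr_mem : ∀ k, r k ∈ Ioc 0 t₀ := fun k =>
    ⟨by positivity, mul_le_of_le_one_right ht₀.le (pow_le_one₀ (by norm_num) (by norm_num))⟩
  have hr4 : ∀ k, r k = 4 * r (k + 1) := fun k => by simp only [hr_def, pow_succ]; ring
  have hr0 : Filter.Tendsto r Filter.atTop (nhds 0) := by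
    simpa [hr_def] using (tendsto_pow_atTop_nhds_zero_of_lt_one (r := (1 / 4 : ℝ)) (by norm_num)
      (by norm_num)).const_mul t₀
  have hr1_mem : ∀ k, r (k + 1) ∈ Ioc 0 t₀ := fun k => hr_mem (k + 1)
  set e : ℕ → ℝ := fun k => η (r (k + 1)) with he_def
  have he_pos : ∀ k, 0 < e k := fun k => hη_pos _ (hr1_mem k)
  have he_le : ∀ k, e k ≤ r (k + 1) := fun k => hη_le _ (hr1_mem k)
  set A : ℕ → ℝ := fun k => Real.log (4 * r (k + 1) + e k) - Real.log (e k) with hA_def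
  set B : ℕ → ℝ := fun k => Real.log (2 * r (k + 1)) - Real.log (e k) with hB_def
  have hB_pos : ∀ k, 0 < B k := fun k =>
    sub_pos.2 (Real.log_lt_log (he_pos k) (by linarith [he_le k, (hr1_mem k).1]))
  have hBA : ∀ k, B k + Real.log 2 ≤ A k := fun k => by
    have h1 := (hr1_mem k).1
    have h2 : Real.log (2 * r (k + 1)) + Real.log 2 = Real.log (4 * r (k + 1)) := by
      rw [← Real.log_mul (by positivity) (by norm_num)]; ring_nf
    have h3 : Real.log (4 * r (k + 1)) ≤ Real.log (4 * r (k + 1) + e k) :=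
      Real.log_le_log (by positivity) (by linarith [he_pos k])
    simp only [hA_def, hB_def]
    linarith
  have hl2 : 0 < Real.log 2 := Real.log_pos one_lt_two
  have hA_pos : ∀ k, 0 < A k := fun k => by linarith [hBA k, hB_pos k]
  have hA_le : ∀ k, A k ≤ Real.log (5 * r (k + 1) / η (r (k + 1))) := fun k => by
    have h1 := (hr1_mem k).1
    rw [Real.log_div (by positivity) (he_pos k).ne']
    refine sub_le_sub_right (Real.log_le_log ?_ ?_) _
    · linarith [he_pos k]
    · linarith [he_le k]
  set M : ℕ → ℝ := fun k => ∏ i ∈ Finset.range k, B i / A i with hM_def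
  have hM_pos : ∀ k, 0 < M k := fun k =>
    Finset.prod_pos fun i _ => div_pos (hB_pos i) (hA_pos i)
  have hM_succ : ∀ k, M (k + 1) = M k * (B k / A k) := fun k => Finset.prod_range_succ _ _
  have hM0 : Filter.Tendsto M Filter.atTop (nhds 0) := by
    refine tendsto_prod_zero_of_not_summable
      (κ := fun k => Real.log 2 / Real.log (5 * r (k + 1) / η (r (k + 1))))
      (fun k => (div_pos (hB_pos k) (hA_pos k)).le)
      (fun k => div_nonneg hl2.le ((hA_pos k).le.trans (hA_le k))) (fun k => ?_) fun hs =>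
      not_summable_of_lintegral_eq_top hη_pos hη_mono hη_le hdiv hr_mem hr4 hr0
        -- The shift by one appears because barrier `k` is built from the domain at scale `r (k +
        -- 1)`.
        ((summable_nat_add_iff 1).1 hs)
    have h1 : Real.log 2 / Real.log (5 * r (k + 1) / η (r (k + 1))) ≤ Real.log 2 / A k :=
      div_le_div_of_nonneg_left hl2.le (hA_pos k) (hA_le k)
    have h2 : B k / A k + Real.log 2 / A k ≤ 1 := by
      rw [← add_div]; exact (div_le_one (hA_pos k)).2 (hBA k)
    linarith
  have hD_pos : ∀ k, ∀ z ∈ Ω, e k < boundaryDist (Ω' (r (k + 1))) z := fun k z hz => by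
    linarith [hge _ (hr1_mem k) z hz, boundaryDist_pos hΩo hne hz]
  have hφc : ∀ k, ContinuousOn (fun z => -Real.log (boundaryDist (Ω' (r (k + 1))) z)) Ω :=
    fun k => ((continuous_boundaryDist _).continuousOn.log fun z hz =>
      ((he_pos k).trans (hD_pos k z hz)).ne').neg
  have hΩsub : ∀ k, Ω ⊆ Ω' (r (k + 1)) := fun k => subset_closure.trans (hsub _ (hr1_mem k))
  refine isHyperconvexDomain_of_barriers (r := r) (M := M)
    (w := fun k z => M k / A k *
      (-Real.log (boundaryDist (Ω' (r (k + 1))) z) + Real.log (e k)))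
    hΩo hΩc hbdd hne ?_ (fun k => (hr_mem k).1) hr0 (by simp [hM_def]) hM0 ?_ ?_ ?_ ?_ ?_
  · exact antitone_nat_of_succ_le fun k => by linarith [hr4 k, (hr1_mem k).1]
  · intro k z hz hzr
    have h1 : Real.log (boundaryDist (Ω' (r (k + 1))) z) ≤ Real.log (2 * r (k + 1)) :=
      Real.log_le_log ((he_pos k).trans (hD_pos k z hz)) (by linarith [hle _ (hr1_mem k) z])
    have h2 : -M (k + 1) = M k / A k * -B k := by rw [hM_succ]; ring
    rw [h2]
    refine mul_le_mul_of_nonneg_left ?_ (div_pos (hM_pos k) (hA_pos k)).le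
    simp only [hB_def]
    linarith
  · intro k z hz hzr
    have h1 : Real.log (4 * r (k + 1) + e k) ≤ Real.log (boundaryDist (Ω' (r (k + 1))) z) :=
      Real.log_le_log (by linarith [he_pos k, (hr1_mem k).1])
        (by linarith [hge _ (hr1_mem k) z hz, hr4 k])
    have h2 : -M k = M k / A k * -A k := by
      have := (hA_pos k).ne'
      field_simp
    rw [h2]
    refine mul_le_mul_of_nonneg_left ?_ (div_pos (hM_pos k) (hA_pos k)).le
    simp only [hA_def]
    linarith
  · exact fun k => continuousOn_const.mul ((hφc k).add continuousOn_const)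
  · exact fun k => (((hΩ' _ (hr1_mem k)).2.2).mono (hΩsub k)).mul_add_const (hφc k)
      (div_pos (hM_pos k) (hA_pos k)).le _
  · intro k z hz
    have := Real.log_lt_log (he_pos k) (hD_pos k z hz)
    exact mul_neg_of_pos_of_neg (div_pos (hM_pos k) (hA_pos k)) (by linarith)
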